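/- Let $n\ge 0$. A real $(n+1)\times(n+1)$ matrix is *totally positive* if all its minors are positive. Index rows, columns and heights by $0,\dots,n$. Let $t=(t_{i,j})_{0\le i,j\le n}$ be an array of positive real numbers. The *essential planar network* $N(t)$ of order $n$ has the vertices $(x,y)$ with $0\le x\le 2n+1$, $0\le y\le n$, the sources $(0,i)$, the sinks $(2n+1,j)$, and the following weighted edges, all directed from left to right: * for $0\le x<n$: the horizontal edges $(x,y)\to(x+1,y)$ of weight $1$, and the fall edges $(x,y)\to(x+1,y-1)$ with $y\ge n-x$, of weight $t_{y,\,x+y-n}$; * for $x=n$: the horizontal edges $(n,y)\to(n+1,y)$ of weight $t_{y,y}$; * for $x=n+1+i$ with $0\le i<n$: the horizontal edges $(x,y)\to(x+1,y)$ of weight $1$, and the rise edges $(x,y)\to(x+1,y+1)$ with $i\le y<n$, of weight $t_{y-i,\,y+1}$. The *weight matrix* of such a network, or of the part of it between two vertical lines, has as its $(i,j)$ entry the sum, over all directed paths from the vertex of height $i$ on the left line to the vertex of height $j$ on the right line, of the product of the weights of the edges of the path. A network of width $n$ starting at a line $x=m$ is the *$L$-type* network with weights $t$ if its edges are the horizontal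 edges of weight $1$ and the fall edges $(m+i,y)\to(m+i+1,y-1)$, $0\le i<n$, $y\ge n-i$, of weight $t_{y,\,i+y-n}$; it is the *$U$-type* network with weights $t$ if its edges are the horizontal edges of weight $1$ and the rise edges $(m+i,y)\to(m+i+1,y+1)$, $0\le i<n$, $i\le y<n$, of weight $t_{y-i,\,y+1}$. The *$D$-type* network of width $1$ has only the horizontal edges $(m,y)\to(m+1,y)$, of weight $t_{y,y}$. **Theorem.** Let $A$ be a totally positive $(n+1)\times(n+1)$ matrix. Then there is exactly one positive array $t$ such that the weight matrix of $N(t)$ is $A$; call $N(t)$ the essential planar network associated with $A$. Cutting it along the lines $x=n$ and $x=n+1$ decomposes it into the $L$-type network (between $x=0$ and $x=n$), the $D$-type network (between $x=n$ and $x=n+1$) and the $U$-type network (between $x=n+1$ and $x=2n+1$) with weights $t$. Let $L$, $D$, $U$ be the weight matrices of these three pieces. Then $L$ is unit lower triangular, $D$ is diagonal, $U$ is unit upper triangular, $A=LDU$, and this is the only factorization of $A$ into a unit lower triangular, a diagonal and a unit upper triangular matrix, in this order. -/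

import Mathlib

namespace TPNetwork

/-- A square real matrix is totally positive if all of its minors are positive. -/
def IsTotallyPositive {n : ℕ} (A : Matrix (Fin (n + 1)) (Fin (n + 1)) ℝ) : Prop :=
  ∀ (k : ℕ) (r c : Fin k ↪o Fin (n + 1)), 0 < (A.submatrix r c).det

/-- Lower triangular with ones on the diagonal. -/
def IsUnitLowerTriangular {n : ℕ} (L : Matrix (Fin (n + 1)) (Fin (n + 1)) ℝ) : Prop :=
  L.IsLowerTriangular ∧ ∀ i, L i i = 1

/-- Upper triangular with ones on the diagonal. -/
def IsUnitUpperTriangular {n : ℕ} (U : Matrix (Fin (n + 1)) (Fin (n + 1)) ℝ) : Prop :=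
  U.IsUpperTriangular ∧ ∀ i, U i i = 1

/-- `A = L * D * U` is an LDU factorization of `A`. -/
structure IsLDU {n : ℕ} (A L D U : Matrix (Fin (n + 1)) (Fin (n + 1)) ℝ) : Prop where
  lower : IsUnitLowerTriangular L
  diag : D.IsDiag
  upper : IsUnitUpperTriangular U
  eq_mul : A = L * D * U

/-- A weighted planar network of order `n`, drawn between the vertical lines `left` and
`left + width`. Its vertices are the points `(x, y)` with `left ≤ x ≤ left + width` and
`0 ≤ y ≤ n`; its sources are the `n + 1` vertices on the left line and its sinks the `n + 1`
vertices on the right line. `Edge x y y'` says that the straight segment directed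
from `(x, y)` to `(x + 1, y')` is an edge, and `weight x y y'` is then the weight of this edge.
Edges lie between the two lines and do not cross. So that the weights carry no information
away from the edges, they are set to `0` there. -/
@[ext]
structure PlanarNetwork (n : ℕ) where
  left : ℕ
  width : ℕ
  Edge : ℕ → Fin (n + 1) → Fin (n + 1) → Prop
  weight : ℕ → Fin (n + 1) → Fin (n + 1) → ℝ
  edge_mem : ∀ x y y', Edge x y y' → left ≤ x ∧ x < left + width
  planar : ∀ x y y' z z', Edge x y y' → Edge x z z' → y < z → y' ≤ z'
  weight_eq_zero : ∀ x y y', ¬ Edge x y y' → weight x y y' = 0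

namespace PlanarNetwork

variable {n : ℕ}

/-- `p` is the sequence of heights of the vertices of a path of `N` from source `i` to
sink `j`. -/
def IsPath (N : PlanarNetwork n) (i j : Fin (n + 1)) (p : Fin (N.width + 1) → Fin (n + 1)) :
    Prop :=
  p 0 = i ∧ p (Fin.last N.width) = j ∧
    ∀ k : Fin N.width, N.Edge (N.left + k) (p k.castSucc) (p k.succ)

/-- The weight of a path: the product of the weights of its edges. -/
noncomputable def pathWeight (N : PlanarNetwork n) (p : Fin (N.width + 1) → Fin (n + 1)) : ℝ :=
  ∏ k : Fin N.width, N.weight (N.left + k) (p k.castSucc) (p k.succ)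

open Classical in
/-- The weight matrix: entry `(i, j)` is the sum of the weights of all paths from source `i`
to sink `j`. -/
noncomputable def weightMatrix (N : PlanarNetwork n) : Matrix (Fin (n + 1)) (Fin (n + 1)) ℝ :=
  Matrix.of fun i j =>
    ∑ p ∈ (Finset.univ : Finset (Fin (N.width + 1) → Fin (n + 1))).filter (N.IsPath i j),
      N.pathWeight p

open Classical in
/-- The weighted sub-network of `N` between the vertical lines `a` and `a + w`. -/
noncomputable def cut (N : PlanarNetwork n) (a w : ℕ) : PlanarNetwork n where
  left := a
  width := w
  Edge x y y' := (a ≤ x ∧ x < a + w) ∧ N.Edge x y y'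
  weight x y y' := if a ≤ x ∧ x < a + w then N.weight x y y' else 0
  edge_mem _ _ _ h := h.1
  planar x y y' z z' h h' := N.planar x y y' z z' h.2 h'.2
  weight_eq_zero x y y' h := by
    by_cases hx : a ≤ x ∧ x < a + w
    · rw [if_pos hx]
      exact N.weight_eq_zero x y y' fun he => h ⟨hx, he⟩
    · rw [if_neg hx]

end PlanarNetwork

/-- Horizontal edge `[(x, y), (x + 1, y)]` of a network on the strip from `m` to `m + w`. -/
abbrev HStep {n : ℕ} (m w x : ℕ) (y y' : Fin (n + 1)) : Prop :=
  (m ≤ x ∧ x < m + w) ∧ y' = y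

/-- Fall edge `[(m + i, y), (m + i + 1, y - 1)]`, where `x = m + i`, `i < n` and `y ≥ n - i`. -/
abbrev FallStep {n : ℕ} (m x : ℕ) (y y' : Fin (n + 1)) : Prop :=
  (m ≤ x ∧ x < m + n) ∧ y'.val + 1 = y.val ∧ n ≤ y.val + (x - m)

/-- Rise edge `[(m + i, y), (m + i + 1, y + 1)]`, where `x = m + i`, `i < n` and `y ≥ i`. -/
abbrev RiseStep {n : ℕ} (m x : ℕ) (y y' : Fin (n + 1)) : Prop :=
  (m ≤ x ∧ x < m + n) ∧ y'.val = y.val + 1 ∧ x - m ≤ y.val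

/-- The `L`-type network of order `n` starting at the line `m`: its edges are the horizontal
edges, of weight `1`, and the fall edges `[(m + i, y), (m + i + 1, y - 1)]` with `y ≥ n - i`,
of weight `t y (i + y - n)`. -/
noncomputable def LNetwork {n : ℕ} (m : ℕ) (t : Fin (n + 1) → Fin (n + 1) → ℝ) :
    PlanarNetwork n where
  left := m
  width := n
  Edge x y y' := HStep m n x y y' ∨ FallStep m x y y'
  weight x y y' :=
    if HStep m n x y y' then 1
    else if h : FallStep m x y y' then t y ⟨(x - m) + y.val - n, by omega⟩
    else 0
  edge_mem x y y' h := by rcases h with h | h <;> exact h.1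
  planar x y y' z z' h h' hyz := by
    rcases h with ⟨_, h⟩ | ⟨_, h, _⟩ <;> rcases h' with ⟨_, h'⟩ | ⟨_, h', _⟩ <;>
      simp only [Fin.lt_def, Fin.le_def, Fin.ext_iff] at * <;> omega
  weight_eq_zero x y y' h := by
    rw [not_or] at h
    rw [if_neg h.1, dif_neg h.2]

/-- The `D`-type network of order `n` starting at the line `m`: its edges are the horizontal
edges `[(m, y), (m + 1, y)]`, of weight `t y y`. -/
noncomputable def DNetwork {n : ℕ} (m : ℕ) (t : Fin (n + 1) → Fin (n + 1) → ℝ) :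
    PlanarNetwork n where
  left := m
  width := 1
  Edge x y y' := HStep m 1 x y y'
  weight x y y' := if HStep m 1 x y y' then t y y else 0
  edge_mem x y y' h := h.1
  planar x y y' z z' h h' hyz := by rw [h.2, h'.2]; exact hyz.le
  weight_eq_zero x y y' h := if_neg h

/-- The `U`-type network of order `n` starting at the line `m`: its edges are the horizontal
edges, of weight `1`, and the rise edges `[(m + i, y), (m + i + 1, y + 1)]` with `y ≥ i`,
of weight `t (y - i) (y + 1)`. -/
noncomputable def UNetwork {n : ℕ} (m : ℕ) (t : Fin (n + 1) → Fin (n + 1) → ℝ) :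
    PlanarNetwork n where
  left := m
  width := n
  Edge x y y' := HStep m n x y y' ∨ RiseStep m x y y'
  weight x y y' :=
    if HStep m n x y y' then 1
    else if RiseStep m x y y' then t ⟨y.val - (x - m), by omega⟩ y'
    else 0
  edge_mem x y y' h := by rcases h with h | h <;> exact h.1
  planar x y y' z z' h h' hyz := by
    rcases h with ⟨_, h⟩ | ⟨_, h, _⟩ <;> rcases h' with ⟨_, h'⟩ | ⟨_, h', _⟩ <;>
      simp only [Fin.lt_def, Fin.le_def, Fin.ext_iff] at * <;> omega
  weight_eq_zero x y y' h := by
    rw [not_or] at h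
    rw [if_neg h.1, if_neg h.2]

/-- The essential planar network of order `n` with weighting `t`, on the strip from `0` to
`2 * n + 1`. For `0 ≤ x < n` there are the fall edges `[(x, y), (x + 1, y - 1)]` with
`y ≥ n - x`, of weight `t y (x + y - n)`, and the horizontal edges, of weight `1`; for `x = n`
the horizontal edges, of weight `t y y`; for `x = n + 1 + i` with `0 ≤ i < n` the rise edges
`[(x, y), (x + 1, y + 1)]` with `y ≥ i`, of weight `t (y - i) (y + 1)`, and the
horizontal edges, of weight `1`. -/
noncomputable def essentialNetwork {n : ℕ} (t : Fin (n + 1) → Fin (n + 1) → ℝ) :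
    PlanarNetwork n where
  left := 0
  width := 2 * n + 1
  Edge x y y' :=
    if x < n then y' = y ∨ FallStep 0 x y y'
    else if x = n then y' = y
    else if x < 2 * n + 1 then y' = y ∨ RiseStep (n + 1) x y y'
    else False
  weight x y y' :=
    if x < n then
      if y' = y then 1
      else if h : FallStep 0 x y y' then t y ⟨x + y.val - n, by omega⟩
      else 0
    else if x = n then
      if y' = y then t y y else 0
    else if x < 2 * n + 1 then
      if y' = y then 1
      else if RiseStep (n + 1) x y y' then t ⟨y.val - (x - (n + 1)), by omega⟩ y'
      else 0
    else 0
  edge_mem x y y' h := by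
    split_ifs at h <;> omega
  planar x y y' z z' h h' hyz := by
    simp only [Fin.lt_def, Fin.le_def, Fin.ext_iff] at *
    split_ifs at h h' <;> omega
  weight_eq_zero x y y' h := by
    split_ifs at h ⊢ <;> tauto

/-- An essential positive weighting: all parameters are positive. -/
def IsPositiveWeighting {n : ℕ} (t : Fin (n + 1) → Fin (n + 1) → ℝ) : Prop :=
  ∀ i j, 0 < t i j

end TPNetwork

namespace TPNetwork

/-! A weight matrix is the product of the transfer matrices of the unit strips, so cutting N(t) at x
= n and x = n + 1 factors it as LDU. Such a factorization with nonsingular D is unique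
(`IsLDU.unique`). Read from right to left, the U-type network is an L-type one with transposed
weights, so everything reduces to the matrices `lowerFactor t`.

These are treated by induction on the order, peeling off the last strip. Only there can a fall reach
height 0, so deleting the first row and last column leaves an L-type matrix of order one less times
an upper bidiagonal matrix, with diagonal t_{i+1,i} and ones above it (`submatrix_lowerFactor`).
This is an LU factorization: its uniqueness recovers the weights below the diagonal
(`lowerFactor_injective`), and its existence produces them (`exists_lowerFactor_eq`).

Positivity is carried by the minors on consecutive rows and initial columns. Their positivity passes
from LR to L while forcing a positive diagonal on R (`HasPosLeftMinors.of_mul`), and passes from L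
to the block above. Total positivity of A and Aᵀ starts the two inductions. -/

section Development

open Matrix

/-! ### LU factorizations and initial-column minors -/

section Triangular

variable {m : ℕ}

theorem mul_apply_self_of_isLowerTriangular {A B : Matrix (Fin m) (Fin m) ℝ}
    (hA : A.IsLowerTriangular) (hB : B.IsLowerTriangular) (i : Fin m) :
    (A * B) i i = A i i * B i i := by
  rw [mul_apply]
  refine Finset.sum_eq_single i (fun j _ hj => ?_) (by simp)
  rcases lt_or_gt_of_ne hj with h | h
  · rw [hB h, mul_zero]
  · rw [hA h, zero_mul]

theorem mul_apply_self_of_isUpperTriangular {A B : Matrix (Fin m) (Fin m) ℝ}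
    (hA : A.IsUpperTriangular) (hB : B.IsUpperTriangular) (i : Fin m) :
    (A * B) i i = A i i * B i i := by
  rw [mul_apply]
  refine Finset.sum_eq_single i (fun j _ hj => ?_) (by simp)
  rcases lt_or_gt_of_ne hj with h | h
  · rw [hA h, zero_mul]
  · rw [hB h, mul_zero]

theorem det_eq_one_of_unit_lower {L : Matrix (Fin m) (Fin m) ℝ}
    (hL : L.IsLowerTriangular) (h1 : ∀ i, L i i = 1) : L.det = 1 := by
  rw [det_of_isLowerTriangular L hL]
  simp [h1]

theorem inv_unit_lower {L : Matrix (Fin m) (Fin m) ℝ}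
    (hL : L.IsLowerTriangular) (h1 : ∀ i, L i i = 1) :
    L⁻¹.IsLowerTriangular ∧ (∀ i, L⁻¹ i i = 1) ∧ L⁻¹ * L = 1 ∧ L * L⁻¹ = 1 := by
  have hu : IsUnit L.det := by rw [det_eq_one_of_unit_lower hL h1]; exact isUnit_one
  let _ := L.invertibleOfIsUnitDet hu
  have hK : L⁻¹.IsLowerTriangular := blockTriangular_inv_of_blockTriangular hL
  refine ⟨hK, fun i => ?_, nonsing_inv_mul _ hu, mul_nonsing_inv _ hu⟩
  have := mul_apply_self_of_isLowerTriangular hK hL i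
  rwa [nonsing_inv_mul _ hu, one_apply_eq, h1, mul_one, eq_comm] at this

/-- The matrix L₂⁻¹L₁ = R₂R₁⁻¹ is both lower and upper triangular with unit diagonal, hence 1.
Comparing determinants makes R₁ invertible too. -/
theorem lower_upper_unique {L₁ L₂ R₁ R₂ : Matrix (Fin m) (Fin m) ℝ}
    (hL₁ : L₁.IsLowerTriangular) (h₁ : ∀ i, L₁ i i = 1)
    (hL₂ : L₂.IsLowerTriangular) (h₂ : ∀ i, L₂ i i = 1)
    (hR₁ : R₁.IsUpperTriangular) (hR₂ : R₂.IsUpperTriangular) (hdet : R₂.det ≠ 0)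
    (h : L₁ * R₁ = L₂ * R₂) : L₁ = L₂ ∧ R₁ = R₂ := by
  have hd : R₁.det = R₂.det := by
    have := congrArg det h
    rwa [det_mul, det_mul, det_eq_one_of_unit_lower hL₁ h₁, det_eq_one_of_unit_lower hL₂ h₂,
      one_mul, one_mul] at this
  obtain ⟨hK, hK1, hKL, hLK⟩ := inv_unit_lower hL₂ h₂
  have hu : IsUnit R₁.det := by rw [hd]; exact hdet.isUnit
  let _ := R₁.invertibleOfIsUnitDet hu
  have hS : R₁⁻¹.IsUpperTriangular := blockTriangular_inv_of_blockTriangular hR₁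
  have e1 : L₂⁻¹ * L₁ = R₂ * R₁⁻¹ := by
    calc L₂⁻¹ * L₁ = L₂⁻¹ * (L₁ * R₁) * R₁⁻¹ := by
          rw [Matrix.mul_assoc, Matrix.mul_assoc, mul_nonsing_inv _ hu, Matrix.mul_one]
      _ = R₂ * R₁⁻¹ := by rw [h, ← Matrix.mul_assoc, hKL, Matrix.one_mul]
  have hlow : (L₂⁻¹ * L₁).IsLowerTriangular := hK.mul hL₁
  have hupp : (L₂⁻¹ * L₁).IsUpperTriangular := by rw [e1]; exact hR₂.mul hS
  have e2 : L₂⁻¹ * L₁ = 1 := by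
    ext i j
    rcases lt_trichotomy i j with hij | rfl | hij
    · rw [hlow hij, one_apply_ne hij.ne]
    · rw [mul_apply_self_of_isLowerTriangular hK hL₁, hK1, h₁, one_mul, one_apply_eq]
    · rw [hupp hij, one_apply_ne hij.ne']
  have e3 : L₁ = L₂ := by
    rw [← Matrix.one_mul L₁, ← hLK, Matrix.mul_assoc, e2, Matrix.mul_one]
  refine ⟨e3, ?_⟩
  rw [← Matrix.one_mul R₁, ← hKL, Matrix.mul_assoc, ← e3, h, ← Matrix.mul_assoc, e3, hKL,
    Matrix.one_mul]

/-- A square matrix all of whose leading principal minors are nonzero has an `LU` factorization. -/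
theorem exists_lower_mul_upper : ∀ {m : ℕ} (M : Matrix (Fin m) (Fin m) ℝ),
    (∀ k (h : k ≤ m), (M.submatrix (Fin.castLE h) (Fin.castLE h)).det ≠ 0) →
    ∃ L R : Matrix (Fin m) (Fin m) ℝ, L.IsLowerTriangular ∧ (∀ i, L i i = 1) ∧
      R.IsUpperTriangular ∧ M = L * R
  | 0, _, _ => ⟨1, 1, fun i => i.elim0, fun i => i.elim0, fun i => i.elim0,
      Subsingleton.elim _ _⟩
  | m + 1, M, hM => by
    obtain ⟨L, R, hL, h1, hR, hLR⟩ :=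
      exists_lower_mul_upper (M.submatrix Fin.castSucc Fin.castSucc)
        fun k h => hM k (h.trans m.le_succ)
    have hdet : IsUnit R.det := by
      have := hM m m.le_succ
      change (M.submatrix Fin.castSucc Fin.castSucc).det ≠ 0 at this
      rw [hLR, det_mul, det_eq_one_of_unit_lower hL h1, one_mul] at this
      exact this.isUnit
    obtain ⟨-, -, -, hLK⟩ := inv_unit_lower hL h1
    -- Bordering: the new row l of L and column r of R solve lR = last row of M and Lr = last column
    -- of M; the corner of R is then the Schur complement.
    set l : Fin m → ℝ := (fun j => M (Fin.last m) j.castSucc) ᵥ* R⁻¹ with hl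
    set r : Fin m → ℝ := L⁻¹ *ᵥ fun i => M i.castSucc (Fin.last m) with hr
    have hl' : l ᵥ* R = fun j => M (Fin.last m) j.castSucc := by
      rw [hl, vecMul_vecMul, nonsing_inv_mul _ hdet, vecMul_one]
    have hr' : L *ᵥ r = fun i => M i.castSucc (Fin.last m) := by
      rw [hr, mulVec_mulVec, hLK, one_mulVec]
    refine ⟨of (Fin.snoc (fun i => Fin.snoc (L i) 0) (Fin.snoc l 1)),
      of (Fin.snoc (fun i => Fin.snoc (R i) (r i))
        (Fin.snoc (fun _ => 0) (M (Fin.last m) (Fin.last m) - l ⬝ᵥ r))), ?_, ?_, ?_, ?_⟩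
    · intro i j hij
      change i < j at hij
      induction i using Fin.lastCases with
      | last => exact absurd hij (Fin.le_last j).not_gt
      | cast i =>
        induction j using Fin.lastCases with
        | last => simp
        | cast j => simpa using hL (show i < j by simpa using hij)
    · intro i
      induction i using Fin.lastCases with
      | last => simp
      | cast i => simpa using h1 i
    · intro i j hij
      change j < i at hij
      induction j using Fin.lastCases with
      | last => exact absurd hij (Fin.le_last i).not_gt
      | cast j =>
        induction i using Fin.lastCases with
        | last => simp
        | cast i => simpa using hR (show j < i by simpa using hij)
    · ext i j
      rw [mul_apply, Fin.sum_univ_castSucc]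
      induction i using Fin.lastCases with
      | last =>
        induction j using Fin.lastCases with
        | last => simp [dotProduct]
        | cast j => simpa [vecMul, dotProduct] using (congrFun hl' j).symm
      | cast i =>
        induction j using Fin.lastCases with
        | last => simpa [mulVec, dotProduct] using (congrFun hr' i).symm
        | cast j => simpa [mul_apply] using congrFun (congrFun hLR i) j

/-- The minors on consecutive rows and on the first columns are positive. -/
def HasPosLeftMinors (M : Matrix (Fin m) (Fin m) ℝ) : Prop :=
  ∀ (k a : ℕ) (h : a + k ≤ m),
    0 < (M.submatrix (fun i : Fin k => (⟨a + i, by omega⟩ : Fin m))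
      (Fin.castLE (by omega))).det

theorem HasPosLeftMinors.leading {M : Matrix (Fin m) (Fin m) ℝ} (hM : HasPosLeftMinors M)
    (k : ℕ) (h : k ≤ m) : 0 < (M.submatrix (Fin.castLE h) (Fin.castLE h)).det := by
  have := hM k 0 (by omega)
  convert this using 3
  ext i
  simp

/-- The first k columns of R vanish below row k, so in Cauchy–Binet terms only one set of
intermediate indices survives. -/
theorem submatrix_mul_upper {L R : Matrix (Fin m) (Fin m) ℝ} (hR : R.IsUpperTriangular)
    {k : ℕ} (h : k ≤ m) (f : Fin k → Fin m) :
    (L * R).submatrix f (Fin.castLE h) =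
      L.submatrix f (Fin.castLE h) * R.submatrix (Fin.castLE h) (Fin.castLE h) := by
  ext i j
  simp only [submatrix_apply, mul_apply]
  symm
  refine Finset.sum_of_injOn (Fin.castLE h) (Fin.castLE_injective h).injOn (by simp)
    (fun x _ hx => ?_) fun _ _ => rfl
  rw [hR, mul_zero]
  change Fin.castLE h j < x
  by_contra hlt
  have hle : x.val ≤ j.val := by simpa [Fin.le_def] using hlt
  exact hx ⟨⟨x, by omega⟩, by simp, by ext; simp⟩

theorem isUpperTriangular_castLE {R : Matrix (Fin m) (Fin m) ℝ} (hR : R.IsUpperTriangular)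
    {k : ℕ} (h : k ≤ m) : (R.submatrix (Fin.castLE h) (Fin.castLE h)).IsUpperTriangular :=
  fun _ _ hij => hR (show Fin.castLE h _ < Fin.castLE h _ from hij)

theorem isLowerTriangular_castLE {L : Matrix (Fin m) (Fin m) ℝ} (hL : L.IsLowerTriangular)
    {k : ℕ} (h : k ≤ m) : (L.submatrix (Fin.castLE h) (Fin.castLE h)).IsLowerTriangular :=
  fun _ _ hij => hL (show Fin.castLE h _ < Fin.castLE h _ from hij)

/-- Each such minor of LR is the one of L times a leading minor of R. As L is unit triangular, the
leading minors of R are those of LR, and `R i i` is a quotient of two consecutive ones. -/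
theorem HasPosLeftMinors.of_mul {L R : Matrix (Fin m) (Fin m) ℝ}
    (hL : L.IsLowerTriangular) (h1 : ∀ i, L i i = 1) (hR : R.IsUpperTriangular)
    (hM : HasPosLeftMinors (L * R)) : (∀ i, 0 < R i i) ∧ HasPosLeftMinors L := by
  have hdet : ∀ k (h : k ≤ m), 0 < (R.submatrix (Fin.castLE h) (Fin.castLE h)).det := by
    intro k h
    have := hM.leading k h
    rwa [submatrix_mul_upper hR, det_mul,
      det_eq_one_of_unit_lower (isLowerTriangular_castLE hL h) (fun i => h1 _), one_mul] at this
  refine ⟨fun i => ?_, fun k a h => ?_⟩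
  · have e1 := hdet i (by omega)
    have e2 := hdet (i + 1) (by omega)
    rw [det_of_isUpperTriangular (isUpperTriangular_castLE hR _)] at e1 e2
    rw [Fin.prod_univ_castSucc] at e2
    exact (pos_iff_pos_of_mul_pos e2).1 e1
  · have := hM k a h
    rw [submatrix_mul_upper hR, det_mul] at this
    exact (pos_iff_pos_of_mul_pos this).2 (hdet k _)

end Triangular

/-! ### Unit triangular matrices and uniqueness of LDU -/

section UnitLower

variable {n : ℕ}

theorem IsUnitLowerTriangular.one :
    IsUnitLowerTriangular (1 : Matrix (Fin (n + 1)) (Fin (n + 1)) ℝ) :=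
  ⟨blockTriangular_one, fun i => one_apply_eq i⟩

theorem IsUnitLowerTriangular.mul {A B : Matrix (Fin (n + 1)) (Fin (n + 1)) ℝ}
    (hA : IsUnitLowerTriangular A) (hB : IsUnitLowerTriangular B) :
    IsUnitLowerTriangular (A * B) :=
  ⟨hA.1.mul hB.1, fun i => by
    rw [mul_apply_self_of_isLowerTriangular hA.1 hB.1, hA.2, hB.2, one_mul]⟩

theorem IsUnitLowerTriangular.transpose {A : Matrix (Fin (n + 1)) (Fin (n + 1)) ℝ}
    (hA : IsUnitLowerTriangular A) : IsUnitUpperTriangular Aᵀ :=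
  ⟨fun _ _ hij => hA.1 hij, hA.2⟩

theorem IsUnitUpperTriangular.transpose {A : Matrix (Fin (n + 1)) (Fin (n + 1)) ℝ}
    (hA : IsUnitUpperTriangular A) : IsUnitLowerTriangular Aᵀ :=
  ⟨fun _ _ hij => hA.1 hij, hA.2⟩

/-- Every entry strictly below the diagonal survives the deletion of the first row and last column.
-/
theorem IsUnitLowerTriangular.ext_submatrix {A B : Matrix (Fin (n + 2)) (Fin (n + 2)) ℝ}
    (hA : IsUnitLowerTriangular A) (hB : IsUnitLowerTriangular B)
    (h : A.submatrix Fin.succ Fin.castSucc = B.submatrix Fin.succ Fin.castSucc) : A = B := by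
  ext i j
  rcases lt_trichotomy i j with hij | rfl | hij
  · rw [hA.1 hij, hB.1 hij]
  · rw [hA.2, hB.2]
  · obtain ⟨i, rfl⟩ := Fin.exists_succ_eq.2 (Fin.ne_zero_of_lt hij)
    obtain ⟨j, rfl⟩ := Fin.exists_castSucc_eq.2 (Fin.ne_last_of_lt hij)
    exact congrFun (congrFun h i) j

theorem IsDiag.isUpperTriangular {D : Matrix (Fin (n + 1)) (Fin (n + 1)) ℝ} (hD : D.IsDiag) :
    D.IsUpperTriangular := fun i j hij => hD (show i ≠ j from ne_of_gt hij)

theorem IsLDU.unique {A L D U L' D' U' : Matrix (Fin (n + 1)) (Fin (n + 1)) ℝ}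
    (h : IsLDU A L D U) (h' : IsLDU A L' D' U') (hD : ∀ i, D' i i ≠ 0) :
    L = L' ∧ D = D' ∧ U = U' := by
  have hDu := IsDiag.isUpperTriangular h.diag
  have hDu' := IsDiag.isUpperTriangular h'.diag
  have hdiag : ∀ i, (D * U) i i = D i i := fun i => by
    rw [mul_apply_self_of_isUpperTriangular hDu h.upper.1, h.upper.2, mul_one]
  have hdiag' : ∀ i, (D' * U') i i = D' i i := fun i => by
    rw [mul_apply_self_of_isUpperTriangular hDu' h'.upper.1, h'.upper.2, mul_one]
  obtain ⟨e1, e2⟩ := lower_upper_unique h.lower.1 h.lower.2 h'.lower.1 h'.lower.2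
    (hDu.mul h.upper.1) (hDu'.mul h'.upper.1)
    (by
      rw [det_of_isUpperTriangular (hDu'.mul h'.upper.1), Finset.prod_ne_zero_iff]
      exact fun i _ => by rw [hdiag']; exact hD i)
    (by rw [← Matrix.mul_assoc, ← Matrix.mul_assoc, ← h.eq_mul, ← h'.eq_mul])
  have e3 : D = D' := by
    ext i j
    by_cases hij : i = j
    · subst hij
      rw [← hdiag, ← hdiag', e2]
    · rw [h.diag hij, h'.diag hij]
  refine ⟨e1, e3, ?_⟩
  have hu : IsUnit D'.det := by
    rw [det_of_isUpperTriangular hDu']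
    exact (Finset.prod_ne_zero_iff.2 fun i _ => hD i).isUnit
  rw [e3] at e2
  rw [← Matrix.one_mul U, ← nonsing_inv_mul _ hu, Matrix.mul_assoc, e2, ← Matrix.mul_assoc,
    nonsing_inv_mul _ hu, Matrix.one_mul]

end UnitLower

/-! ### Path sums as products of transfer matrices -/

section Transfer

theorem prod_map_range_apply {ι : Type*} [Fintype ι] [DecidableEq ι] (S : ℕ → Matrix ι ι ℝ)
    (w : ℕ) (i j : ι) :
    ((List.range w).map S).prod i j = ∑ p : Fin (w + 1) → ι,
      if p 0 = i ∧ p (Fin.last w) = j then ∏ k : Fin w, S k (p k.castSucc) (p k.succ) else 0 := by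
  induction w generalizing j with
  | zero =>
    rw [← (Equiv.funUnique (Fin 1) ι).symm.sum_comp]
    simp only [List.range_zero, List.map_nil, List.prod_nil, Finset.univ_eq_empty,
      Finset.prod_empty, Equiv.funUnique_symm_apply, uniqueElim_const, one_apply]
    by_cases h : i = j
    · subst h
      simp
    · rw [if_neg h]
      symm
      refine Finset.sum_eq_zero fun x _ => if_neg ?_
      rintro ⟨rfl, rfl⟩
      exact h rfl
  | succ w ih =>
    rw [List.prod_range_succ, mul_apply, ← (Fin.snocEquiv fun _ => ι).sum_comp,
      Fintype.sum_prod_type]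
    simp only [ih, Finset.sum_mul]
    rw [Finset.sum_comm, Finset.sum_comm (γ := ι)]
    refine Finset.sum_congr rfl fun q _ => ?_
    rw [Finset.sum_eq_single (q (Fin.last w)), Finset.sum_eq_single j]
    · simp only [Fin.snocEquiv, Equiv.coe_fn_mk, Fin.prod_univ_castSucc, Fin.snoc_last,
        Fin.snoc_castSucc, Fin.succ_last, Fin.val_last, and_true, Fin.snoc_apply_zero]
      split_ifs
      · simp only [← Fin.castSucc_succ, Fin.snoc_castSucc, Fin.val_castSucc]
      · rw [zero_mul]
    · intro x _ hx
      simp [Fin.snocEquiv, hx]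
    · simp
    · intro x _ hx
      rw [if_neg fun h => hx h.2.symm, zero_mul]
    · simp

/-- Expanding the product sums over all sequences of heights; those that are not paths contribute
zero because weights vanish off the edges. -/
theorem PlanarNetwork.weightMatrix_eq_prod {n : ℕ} (N : PlanarNetwork n) :
    N.weightMatrix =
      ((List.range N.width).map fun k => Matrix.of (N.weight (N.left + k))).prod := by
  ext i j
  rw [prod_map_range_apply, weightMatrix, of_apply, Finset.sum_filter]
  refine Finset.sum_congr rfl fun p _ => ?_
  simp only [of_apply]
  by_cases h : p 0 = i ∧ p (Fin.last N.width) = j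
  · rw [if_pos h]
    split_ifs with hp
    · rfl
    · have : ∃ k : Fin N.width, ¬ N.Edge (N.left + k) (p k.castSucc) (p k.succ) := by
        by_contra hk
        push Not at hk
        exact hp ⟨h.1, h.2, hk⟩
      obtain ⟨k, hk⟩ := this
      exact (Finset.prod_eq_zero (Finset.mem_univ k) (N.weight_eq_zero _ _ _ hk)).symm
  · rw [if_neg h, if_neg fun hp => h ⟨hp.1, hp.2.1⟩]

theorem transpose_prod_map_range {ι : Type*} [Fintype ι] [DecidableEq ι] (S : ℕ → Matrix ι ι ℝ)
    (w : ℕ) : ((List.range w).map S).prodᵀ =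
      ((List.range w).map fun k => (S (w - 1 - k))ᵀ).prod := by
  induction w with
  | zero => simp
  | succ w ih =>
    rw [List.prod_range_succ, transpose_mul, ih, List.prod_range_succ']
    congr 1
    refine congrArg List.prod (List.map_congr_left fun k _ => ?_)
    congr 2
    omega

end Transfer

/-! ### Parametrization of unit lower triangular matrices by L-type networks -/

section Bidiagonal

variable {n : ℕ}

/-- The transfer matrix of the strip between `i` and `i + 1` of the `L`-type network. -/
def fallMatrix (t : Fin (n + 1) → Fin (n + 1) → ℝ) (i : ℕ) :
    Matrix (Fin (n + 1)) (Fin (n + 1)) ℝ :=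
  of fun y y' =>
    if y' = y then 1
    else if h : y'.val + 1 = y.val ∧ n ≤ y.val + i ∧ i < n then t y ⟨i + y.val - n, by omega⟩
    else 0

/-- The weight matrix of the `L`-type network. -/
noncomputable def lowerFactor (t : Fin (n + 1) → Fin (n + 1) → ℝ) :
    Matrix (Fin (n + 1)) (Fin (n + 1)) ℝ :=
  ((List.range n).map (fallMatrix t)).prod

theorem fallMatrix_isUnitLowerTriangular (t : Fin (n + 1) → Fin (n + 1) → ℝ) (i : ℕ) :
    IsUnitLowerTriangular (fallMatrix t i) := by
  refine ⟨fun y y' hy => ?_, fun y => by simp [fallMatrix]⟩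
  change y < y' at hy
  rw [fallMatrix, of_apply, if_neg hy.ne', dif_neg fun h => ?_]
  have := Fin.lt_def.1 hy
  omega

theorem lowerFactor_isUnitLowerTriangular (t : Fin (n + 1) → Fin (n + 1) → ℝ) :
    IsUnitLowerTriangular (lowerFactor t) := by
  have : ∀ w, IsUnitLowerTriangular ((List.range w).map (fallMatrix t)).prod := by
    intro w
    induction w with
    | zero => exact IsUnitLowerTriangular.one
    | succ w ih =>
      rw [List.prod_range_succ]
      exact ih.mul (fallMatrix_isUnitLowerTriangular t w)
  exact this n

/-- A fall weight sits in column i + y - n < y, because i < n. -/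
theorem lowerFactor_congr {t u : Fin (n + 1) → Fin (n + 1) → ℝ}
    (h : ∀ i j, j < i → t i j = u i j) : lowerFactor t = lowerFactor u := by
  refine congrArg List.prod (List.map_congr_left fun i _ => ?_)
  ext y y'
  simp only [fallMatrix, of_apply]
  split_ifs with h1 h2
  · rfl
  · exact h _ _ (Fin.lt_def.2 (by simp only; omega))
  · rfl

/-- The block diagonal matrix `1 ⊕ M`. -/
def prepend {m : ℕ} (M : Matrix (Fin m) (Fin m) ℝ) : Matrix (Fin (m + 1)) (Fin (m + 1)) ℝ :=
  of (Fin.cons (Fin.cons 1 fun _ => 0) fun i => Fin.cons 0 (M i))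

theorem prepend_one {m : ℕ} : prepend (1 : Matrix (Fin m) (Fin m) ℝ) = 1 := by
  ext i j
  refine Fin.cases ?_ (fun i => ?_) i <;> refine Fin.cases ?_ (fun j => ?_) j <;>
    simp [prepend, one_apply, Fin.succ_ne_zero, (Fin.succ_ne_zero _).symm]

theorem prepend_mul {m : ℕ} (M N : Matrix (Fin m) (Fin m) ℝ) :
    prepend (M * N) = prepend M * prepend N := by
  ext i j
  rw [mul_apply, Fin.sum_univ_succ]
  refine Fin.cases ?_ (fun i => ?_) i <;> refine Fin.cases ?_ (fun j => ?_) j <;>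
    simp [prepend, mul_apply]

/-- The weights of the part of an `L`-type network above the height `0`. -/
def shiftWeights (t : Fin (n + 2) → Fin (n + 2) → ℝ) : Fin (n + 1) → Fin (n + 1) → ℝ :=
  fun i j => t i.succ j.castSucc

theorem fallMatrix_eq_prepend (t : Fin (n + 2) → Fin (n + 2) → ℝ) {i : ℕ} (hi : i < n) :
    fallMatrix t i = prepend (fallMatrix (shiftWeights t) i) := by
  ext y y'
  refine Fin.cases ?_ (fun y => ?_) y <;> refine Fin.cases ?_ (fun y' => ?_) y'
  · simp [fallMatrix, prepend]
  · simp [fallMatrix, prepend, Fin.succ_ne_zero]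
  · simp only [fallMatrix, prepend, of_apply, Fin.cons_succ, Fin.cons_zero]
    rw [if_neg (Fin.succ_ne_zero _).symm, dif_neg]
    simp only [Fin.val_zero, Fin.val_succ]
    omega
  · simp only [fallMatrix, prepend, of_apply, Fin.cons_succ, Fin.succ_inj, shiftWeights,
      Fin.val_succ]
    split_ifs with h1 h2 h3 h3
    · rfl
    · congr 1
      ext
      simp only [Fin.val_castSucc]
      omega
    · omega
    · omega
    · rfl

/-- Before the last strip no fall starts at height 1, so height 0 splits off as a direct summand. -/
theorem lowerFactor_succ (t : Fin (n + 2) → Fin (n + 2) → ℝ) :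
    lowerFactor t = prepend (lowerFactor (shiftWeights t)) * fallMatrix t n := by
  rw [lowerFactor, List.prod_range_succ]
  congr 1
  have : ∀ w ≤ n, ((List.range w).map (fallMatrix t)).prod =
      prepend ((List.range w).map (fallMatrix (shiftWeights t))).prod := by
    intro w hw
    induction w with
    | zero => simp [prepend_one]
    | succ w ih =>
      rw [List.prod_range_succ, List.prod_range_succ, ih (by omega), prepend_mul,
        fallMatrix_eq_prepend t (by omega)]
  exact this n le_rfl

/-- The lower left block of the last factor of an `L`-type network. -/
def upperBidiagonal (t : Fin (n + 2) → Fin (n + 2) → ℝ) : Matrix (Fin (n + 1)) (Fin (n + 1)) ℝ :=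
  of fun i j => if j = i then t i.succ i.castSucc else if j.val = i.val + 1 then 1 else 0

theorem upperBidiagonal_isUpperTriangular (t : Fin (n + 2) → Fin (n + 2) → ℝ) :
    (upperBidiagonal t).IsUpperTriangular := by
  intro i j hij
  change j < i at hij
  rw [upperBidiagonal, of_apply, if_neg hij.ne, if_neg]
  have := Fin.lt_def.1 hij
  omega

/-- The deletion shifts the last strip's matrix by one: its falls become the diagonal and its unit
diagonal becomes the superdiagonal. -/
theorem submatrix_lowerFactor (t : Fin (n + 2) → Fin (n + 2) → ℝ) :
    (lowerFactor t).submatrix Fin.succ Fin.castSucc =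
      lowerFactor (shiftWeights t) * upperBidiagonal t := by
  ext i j
  rw [lowerFactor_succ, submatrix_apply, mul_apply, Fin.sum_univ_succ, mul_apply]
  simp only [prepend, of_apply, Fin.cons_succ, Fin.cons_zero, zero_mul, zero_add]
  refine Finset.sum_congr rfl fun k _ => ?_
  congr 1
  simp only [fallMatrix, upperBidiagonal, of_apply, Fin.ext_iff, Fin.val_castSucc, Fin.val_succ]
  split_ifs with h1 h2 h3 h4 h5
  all_goals first | omega | rfl | skip
  congr 1
  ext
  simp only [Fin.val_castSucc]
  omega

theorem det_upperBidiagonal_ne_zero {t : Fin (n + 2) → Fin (n + 2) → ℝ}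
    (ht : IsPositiveWeighting t) : (upperBidiagonal t).det ≠ 0 := by
  rw [det_of_isUpperTriangular (upperBidiagonal_isUpperTriangular t), Finset.prod_ne_zero_iff]
  intro i _
  simpa [upperBidiagonal] using (ht _ _).ne'

theorem IsPositiveWeighting.shiftWeights {t : Fin (n + 2) → Fin (n + 2) → ℝ}
    (ht : IsPositiveWeighting t) : IsPositiveWeighting (shiftWeights t) :=
  fun _ _ => ht _ _

theorem lowerFactor_injective : ∀ {n : ℕ} {t u : Fin (n + 1) → Fin (n + 1) → ℝ},
    IsPositiveWeighting t → IsPositiveWeighting u → lowerFactor t = lowerFactor u →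
    ∀ i j, j < i → t i j = u i j
  | 0, _, _, _, _, _, i, j, hij => by omega
  | n + 1, t, u, ht, hu, h, i, j, hij => by
    have h' := congrArg (fun M => M.submatrix Fin.succ Fin.castSucc) h
    simp only [submatrix_lowerFactor] at h'
    have hL := lowerFactor_isUnitLowerTriangular (shiftWeights t)
    have hL' := lowerFactor_isUnitLowerTriangular (shiftWeights u)
    obtain ⟨e1, e2⟩ := lower_upper_unique hL.1 hL.2 hL'.1 hL'.2
      (upperBidiagonal_isUpperTriangular t) (upperBidiagonal_isUpperTriangular u)
      (det_upperBidiagonal_ne_zero hu) h'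
    obtain ⟨i, rfl⟩ := Fin.exists_succ_eq.2 (Fin.ne_zero_of_lt hij)
    obtain ⟨j, rfl⟩ := Fin.exists_castSucc_eq.2 (Fin.ne_last_of_lt hij)
    rcases (le_iff_lt_or_eq.1 (Fin.castSucc_lt_succ_iff.1 hij)) with hij | rfl
    · exact lowerFactor_injective ht.shiftWeights hu.shiftWeights e1 i j hij
    · simpa [upperBidiagonal] using congrFun (congrFun e2 j) j

theorem exists_lowerFactor_eq : ∀ {n : ℕ} {L : Matrix (Fin (n + 1)) (Fin (n + 1)) ℝ},
    IsUnitLowerTriangular L → HasPosLeftMinors L →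
    ∃ t, IsPositiveWeighting t ∧ lowerFactor t = L
  | 0, L, hL, _ => by
    refine ⟨fun _ _ => 1, fun _ _ => one_pos, ?_⟩
    ext i j
    obtain rfl : j = i := by omega
    rw [hL.2, (lowerFactor_isUnitLowerTriangular _).2]
  | n + 1, L, hL, hpos => by
    have hM : HasPosLeftMinors (L.submatrix Fin.succ Fin.castSucc) := by
      intro k a h
      have := hpos k (a + 1) (by omega)
      refine this.trans_eq (congrArg det ?_)
      ext i j
      exact congrArg₂ L (Fin.ext (by simp only [Fin.val_succ]; omega)) (Fin.ext rfl)
    obtain ⟨L', R, hL', h1, hR, hLR⟩ := exists_lower_mul_upper _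
      fun k h => (hM.leading k h).ne'
    rw [hLR] at hM
    obtain ⟨hRpos, hpos'⟩ := HasPosLeftMinors.of_mul hL' h1 hR hM
    obtain ⟨s, hs, hsL⟩ := exists_lowerFactor_eq ⟨hL', h1⟩ hpos'
    obtain ⟨hK, hK1, hKL, -⟩ := inv_unit_lower hL' h1
    -- The block of L has ones on the superdiagonal and zeros beyond it; multiplying by a unit lower
    -- triangular matrix on the left preserves this, so the upper triangular R is bidiagonal.
    have hR' : R = L'⁻¹ * L.submatrix Fin.succ Fin.castSucc := by
      rw [hLR, ← Matrix.mul_assoc, hKL, Matrix.one_mul]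
    -- Row 0 and the last column contain no entry below the diagonal; the value 1 there only keeps t
    -- positive.
    let t : Fin (n + 2) → Fin (n + 2) → ℝ := Fin.cons (fun _ => 1) fun i =>
      Fin.snoc (fun j => if j = i then R i i else s i j) 1
    have ht : IsPositiveWeighting t := by
      intro i j
      refine Fin.cases (by simp [t]) (fun i => ?_) i
      refine Fin.lastCases (by simp [t]) (fun j => ?_) j
      simp only [t, Fin.cons_succ, Fin.snoc_castSucc]
      split_ifs
      exacts [hRpos i, hs i j]
    refine ⟨t, ht, (lowerFactor_isUnitLowerTriangular t).ext_submatrix hL ?_⟩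
    rw [submatrix_lowerFactor, hLR]
    congr 1
    · rw [← hsL]
      refine lowerFactor_congr fun i j hij => ?_
      simp [t, shiftWeights, hij.ne]
    · ext i j
      rw [upperBidiagonal, of_apply]
      split_ifs with hij hij'
      · subst hij
        simp [t]
      · rw [hR', mul_apply, Finset.sum_eq_single i, hK1, one_mul, submatrix_apply,
          show j.castSucc = i.succ from Fin.ext (by simpa using hij'), hL.2]
        · intro k _ hk
          rcases lt_or_gt_of_ne hk with hk | hk
          · rw [submatrix_apply, hL.1, mul_zero]
            have := Fin.lt_def.1 hk
            change k.succ < j.castSucc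
            simp only [Fin.lt_def, Fin.val_succ, Fin.val_castSucc]
            omega
          · rw [hK hk, zero_mul]
        · simp
      · symm
        rcases lt_or_gt_of_ne hij with h | h
        · exact hR h
        · rw [hR', mul_apply]
          refine Finset.sum_eq_zero fun k _ => ?_
          rcases le_or_gt k i with hk | hk
          · rw [submatrix_apply, hL.1, mul_zero]
            have := Fin.le_def.1 hk
            have := Fin.lt_def.1 h
            change k.succ < j.castSucc
            simp only [Fin.lt_def, Fin.val_succ, Fin.val_castSucc]
            omega
          · rw [hK hk, zero_mul]

end Bidiagonal

/-! ### Weight matrices of the pieces, and cutting -/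

section Networks

variable {n : ℕ}

theorem weightMatrix_LNetwork (m : ℕ) (t : Fin (n + 1) → Fin (n + 1) → ℝ) :
    (LNetwork m t).weightMatrix = lowerFactor t := by
  rw [PlanarNetwork.weightMatrix_eq_prod]
  refine congrArg List.prod (List.map_congr_left fun k hk => ?_)
  have hk' : k < n := List.mem_range.1 hk
  ext y y'
  simp only [LNetwork, fallMatrix, of_apply, HStep, FallStep, Nat.add_sub_cancel_left]
  split_ifs with h1 h2 h3 h4 h5 h6 h7
  all_goals first | rfl | omega

theorem weightMatrix_DNetwork (m : ℕ) (t : Fin (n + 1) → Fin (n + 1) → ℝ) :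
    (DNetwork m t).weightMatrix = diagonal fun i => t i i := by
  rw [PlanarNetwork.weightMatrix_eq_prod]
  ext y y'
  simp [DNetwork, HStep, diagonal_apply, eq_comm]

/-- Transposition reverses the strips: rise strip n - 1 - k becomes fall strip k, with the indices
of the weights swapped. -/
theorem weightMatrix_UNetwork (m : ℕ) (t : Fin (n + 1) → Fin (n + 1) → ℝ) :
    (UNetwork m t).weightMatrix = (lowerFactor fun i j => t j i)ᵀ := by
  rw [PlanarNetwork.weightMatrix_eq_prod, ← transpose_transpose (List.prod _),
    transpose_prod_map_range]
  refine congrArg transpose (congrArg List.prod (List.map_congr_left fun k hk => ?_))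
  have hk' : k < n := List.mem_range.1 hk
  ext y y'
  simp only [UNetwork, fallMatrix, of_apply, transpose_apply, HStep, RiseStep,
    Nat.add_sub_cancel_left]
  split_ifs with h1 h2 h3 h4 h5 h6 h7
  all_goals first | rfl | omega | skip
  congr 1
  ext
  simp only
  omega

theorem cut_essentialNetwork_left (t : Fin (n + 1) → Fin (n + 1) → ℝ) :
    (essentialNetwork t).cut 0 n = LNetwork 0 t := by
  refine PlanarNetwork.ext rfl rfl ?_ ?_ <;> funext x y y'
  · simp only [PlanarNetwork.cut, essentialNetwork, LNetwork, HStep, FallStep, eq_iff_iff]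
    split_ifs <;> omega
  · simp only [PlanarNetwork.cut, essentialNetwork, LNetwork, HStep, FallStep]
    split_ifs
    all_goals first | rfl | omega

theorem cut_essentialNetwork_middle (t : Fin (n + 1) → Fin (n + 1) → ℝ) :
    (essentialNetwork t).cut n 1 = DNetwork n t := by
  refine PlanarNetwork.ext rfl rfl ?_ ?_ <;> funext x y y'
  · simp only [PlanarNetwork.cut, essentialNetwork, DNetwork, HStep, FallStep, eq_iff_iff]
    split_ifs <;> omega
  · simp only [PlanarNetwork.cut, essentialNetwork, DNetwork, HStep, FallStep]
    split_ifs
    all_goals first | rfl | omega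

theorem cut_essentialNetwork_right (t : Fin (n + 1) → Fin (n + 1) → ℝ) :
    (essentialNetwork t).cut (n + 1) n = UNetwork (n + 1) t := by
  refine PlanarNetwork.ext rfl rfl ?_ ?_ <;> funext x y y'
  · simp only [PlanarNetwork.cut, essentialNetwork, UNetwork, HStep, RiseStep, eq_iff_iff]
    split_ifs <;> omega
  · simp only [PlanarNetwork.cut, essentialNetwork, UNetwork, HStep, RiseStep]
    split_ifs
    all_goals first | rfl | omega

theorem weightMatrix_cut (N : PlanarNetwork n) (a w : ℕ) :
    (N.cut a w).weightMatrix =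
      ((List.range w).map fun k => Matrix.of (N.weight (a + k))).prod := by
  rw [PlanarNetwork.weightMatrix_eq_prod]
  refine congrArg List.prod (List.map_congr_left fun k hk => ?_)
  have hk' : k < w := List.mem_range.1 hk
  ext y y'
  simp [PlanarNetwork.cut, hk']

/-- Cutting a network along a vertical line factors its weight matrix. -/
theorem weightMatrix_cut_mul_cut (N : PlanarNetwork n) (a v w : ℕ) :
    (N.cut a (v + w)).weightMatrix =
      (N.cut a v).weightMatrix * (N.cut (a + v) w).weightMatrix := by
  simp only [weightMatrix_cut, List.range_add, List.map_append, List.prod_append, List.map_map]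
  congr 3
  funext k
  simp [Nat.add_assoc]

theorem weightMatrix_essentialNetwork (t : Fin (n + 1) → Fin (n + 1) → ℝ) :
    (essentialNetwork t).weightMatrix =
      ((essentialNetwork t).cut 0 n).weightMatrix * ((essentialNetwork t).cut n 1).weightMatrix *
        ((essentialNetwork t).cut (n + 1) n).weightMatrix := by
  have h := weightMatrix_cut_mul_cut (essentialNetwork t) 0 (n + 1) n
  have h' := weightMatrix_cut_mul_cut (essentialNetwork t) 0 n 1
  rw [Nat.zero_add] at h h'
  rw [← h', ← h, weightMatrix_cut, PlanarNetwork.weightMatrix_eq_prod]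
  change ((List.range (2 * n + 1)).map _).prod = _
  rw [show n + 1 + n = 2 * n + 1 by omega]
  rfl

theorem isLDU_essentialNetwork (t : Fin (n + 1) → Fin (n + 1) → ℝ) :
    IsLDU (essentialNetwork t).weightMatrix ((essentialNetwork t).cut 0 n).weightMatrix
      ((essentialNetwork t).cut n 1).weightMatrix
      ((essentialNetwork t).cut (n + 1) n).weightMatrix where
  lower := by
    rw [cut_essentialNetwork_left, weightMatrix_LNetwork]
    exact lowerFactor_isUnitLowerTriangular t
  diag := by
    rw [cut_essentialNetwork_middle, weightMatrix_DNetwork]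
    exact isDiag_diagonal _
  upper := by
    rw [cut_essentialNetwork_right, weightMatrix_UNetwork]
    exact (lowerFactor_isUnitLowerTriangular _).transpose
  eq_mul := weightMatrix_essentialNetwork t

theorem isLDU_lowerFactor (t : Fin (n + 1) → Fin (n + 1) → ℝ) :
    IsLDU (essentialNetwork t).weightMatrix (lowerFactor t) (diagonal fun i => t i i)
      (lowerFactor fun i j => t j i)ᵀ := by
  have := isLDU_essentialNetwork t
  rwa [cut_essentialNetwork_left, cut_essentialNetwork_middle, cut_essentialNetwork_right,
    weightMatrix_LNetwork, weightMatrix_DNetwork, weightMatrix_UNetwork] at this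

end Networks

/-! ### Totally positive matrices: existence and uniqueness of the weights -/

section TotallyPositive

variable {n : ℕ} {A : Matrix (Fin (n + 1)) (Fin (n + 1)) ℝ}

theorem IsTotallyPositive.transpose (hA : IsTotallyPositive A) : IsTotallyPositive Aᵀ :=
  fun k r c => by
    rw [← det_transpose]
    exact hA k c r

theorem IsTotallyPositive.hasPosLeftMinors (hA : IsTotallyPositive A) : HasPosLeftMinors A :=
  fun k a h => hA k
    (OrderEmbedding.ofStrictMono (fun i : Fin k => (⟨a + i, by omega⟩ : Fin (n + 1)))
      fun i j hij => Fin.lt_def.2 (Nat.add_lt_add_left hij a))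
    (Fin.castLEOrderEmb (by omega))

theorem IsTotallyPositive.exists_isLDU (hA : IsTotallyPositive A) :
    ∃ (L U : Matrix (Fin (n + 1)) (Fin (n + 1)) ℝ) (d : Fin (n + 1) → ℝ),
      IsLDU A L (diagonal d) U ∧ (∀ i, 0 < d i) ∧ HasPosLeftMinors L ∧ HasPosLeftMinors Uᵀ := by
  have hpos := hA.hasPosLeftMinors
  obtain ⟨L, R, hL, h1, hR, hLR⟩ := exists_lower_mul_upper A fun k h => (hpos.leading k h).ne'
  have hpos' := hpos
  rw [hLR] at hpos'
  obtain ⟨hd, hLpos⟩ := HasPosLeftMinors.of_mul hL h1 hR hpos'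
  obtain ⟨U, hU⟩ : ∃ U, U = diagonal (fun i => (R i i)⁻¹) * R := ⟨_, rfl⟩
  have hDU : R = diagonal (fun i => R i i) * U := by
    have h : (fun i => R i i * (R i i)⁻¹) = fun _ => 1 :=
      funext fun i => mul_inv_cancel₀ (hd i).ne'
    rw [hU, ← Matrix.mul_assoc, diagonal_mul_diagonal, h, diagonal_one, Matrix.one_mul]
  have hUU : IsUnitUpperTriangular U := by
    refine ⟨hU ▸ (blockTriangular_diagonal _).mul hR, fun i => ?_⟩
    rw [hU, diagonal_mul, inv_mul_cancel₀ (hd i).ne']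
  have hA' : A = L * diagonal (fun i => R i i) * U := by
    rw [Matrix.mul_assoc, ← hDU, hLR]
  refine ⟨L, U, fun i => R i i, ⟨⟨hL, h1⟩, isDiag_diagonal _, hUU, hA'⟩, hd, hLpos, ?_⟩
  -- Aᵀ = Uᵀ(DLᵀ) is again unit lower times upper triangular, so the minors of Uᵀ are handled like
  -- those of L.
  have hT := hA.transpose.hasPosLeftMinors
  rw [hA', transpose_mul, transpose_mul, diagonal_transpose] at hT
  exact (HasPosLeftMinors.of_mul hUU.transpose.1 hUU.transpose.2
    ((blockTriangular_diagonal _).mul (IsUnitLowerTriangular.transpose ⟨hL, h1⟩).1) hT).2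

theorem IsTotallyPositive.exists_weighting (hA : IsTotallyPositive A) :
    ∃ t, IsPositiveWeighting t ∧ (essentialNetwork t).weightMatrix = A := by
  obtain ⟨L, U, d, h, hd, hL, hU⟩ := hA.exists_isLDU
  obtain ⟨s, hs, hsL⟩ := exists_lowerFactor_eq h.lower hL
  obtain ⟨u, hu, huU⟩ := exists_lowerFactor_eq h.upper.transpose hU
  refine ⟨fun i j => if j < i then s i j else if i = j then d i else u j i, fun i j => ?_, ?_⟩
  · dsimp only
    split_ifs
    exacts [hs i j, hd i, hu j i]
  · have e1 : lowerFactor (fun i j => if j < i then s i j else if i = j then d i else u j i) = L :=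
      (lowerFactor_congr fun i j hij => if_pos hij).trans hsL
    have e2 : lowerFactor (fun i j => if i < j then s j i else if j = i then d j else u i j) =
        Uᵀ := by
      refine (lowerFactor_congr fun i j hij => ?_).trans huU
      rw [if_neg hij.not_gt, if_neg hij.ne]
    rw [(isLDU_lowerFactor _).eq_mul, h.eq_mul, e1, e2, transpose_transpose]
    simp

theorem essentialNetwork_weighting_unique {t u : Fin (n + 1) → Fin (n + 1) → ℝ}
    (ht : IsPositiveWeighting t) (hu : IsPositiveWeighting u)
    (h : (essentialNetwork t).weightMatrix = (essentialNetwork u).weightMatrix) : t = u := by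
  obtain ⟨hL, hD, hU⟩ := (h ▸ isLDU_lowerFactor t).unique (isLDU_lowerFactor u)
    fun i => by simpa using (hu i i).ne'
  funext i j
  rcases lt_trichotomy i j with hij | rfl | hij
  · exact lowerFactor_injective (fun i j => ht j i) (fun i j => hu j i)
      (transpose_injective hU) j i hij
  · simpa using congrFun (congrFun hD i) i
  · exact lowerFactor_injective ht hu hL i j hij

end TotallyPositive

end Development

end TPNetwork

open TPNetwork in
theorem mainTheorem1 (n : ℕ) (A : Matrix (Fin (n + 1)) (Fin (n + 1)) ℝ)
    (hA : IsTotallyPositive A) :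
    -- there is exactly one essential planar network with positive weights associated with `A`
    (∃! t : Fin (n + 1) → Fin (n + 1) → ℝ,
      IsPositiveWeighting t ∧ (essentialNetwork t).weightMatrix = A) ∧
    ∀ t : Fin (n + 1) → Fin (n + 1) → ℝ,
      IsPositiveWeighting t → (essentialNetwork t).weightMatrix = A →
      -- cutting it gives an `L`-type, a `D`-type and a `U`-type network
      (essentialNetwork t).cut 0 n = LNetwork 0 t ∧
      (essentialNetwork t).cut n 1 = DNetwork n t ∧
      (essentialNetwork t).cut (n + 1) n = UNetwork (n + 1) t ∧
      -- whose weight matrices are the factors of an LDU factorization of `A`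
      IsLDU A ((essentialNetwork t).cut 0 n).weightMatrix
        ((essentialNetwork t).cut n 1).weightMatrix
        ((essentialNetwork t).cut (n + 1) n).weightMatrix ∧
      -- and this is the only LDU factorization of `A`
      ∀ L D U : Matrix (Fin (n + 1)) (Fin (n + 1)) ℝ, IsLDU A L D U →
        L = ((essentialNetwork t).cut 0 n).weightMatrix ∧
        D = ((essentialNetwork t).cut n 1).weightMatrix ∧
        U = ((essentialNetwork t).cut (n + 1) n).weightMatrix := by
  obtain ⟨t, ht, htA⟩ := hA.exists_weighting
  refine ⟨⟨t, ⟨ht, htA⟩, fun u hu =>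
    essentialNetwork_weighting_unique hu.1 ht (hu.2.trans htA.symm)⟩, fun t ht htA => ?_⟩
  have h := isLDU_essentialNetwork t
  rw [htA] at h
  refine ⟨cut_essentialNetwork_left t, cut_essentialNetwork_middle t,
    cut_essentialNetwork_right t, h, fun L D U hLDU => hLDU.unique h fun i => ?_⟩
  rw [cut_essentialNetwork_middle, weightMatrix_DNetwork, Matrix.diagonal_apply_eq]
  exact (ht i i).ne'
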